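/- Let the unit cube rest on the square $[0,1]^2$ of the $xy$-plane, with its vertex at $(x,y,z)\in\{0,1\}^3$ labelled $x+2y+4z$. Let $a,b\ge 1$ be coprime. The segment from $(0,0)$ to $t=(a,b)$ contains no other lattice points. Go along it and roll the cube over an edge without slipping, to the right (a letter $r$) whenever the segment crosses a vertical line $x=i$, and upwards (a letter $u$) whenever it crosses a horizontal line $y=j$ ($i,j\in\mathbb Z$). This unfolds a geodesic of the cube that starts at vertex $0$; its end vertex $v(t)$ is the vertex of the cube that touches $(a,b)$ (the upper-right corner of the bottom face) after the last roll. Name diagonal $i\in\{0,1,2,3\}$ of the cube after its end $i$ in the bottom face of the starting position. The orientation $\sigma(t)\in S_4$ after the last roll is the permutation, written in one-line notation $\sigma_0\sigma_1\sigma_2\sigma_3$, for which diagonal $\sigma_i$ is in the starting position of diagonal $i$; equivalently, $\sigma(t)$ is the product of the word of rolls with $r=1230$, $u=2310$ and $(pq)(i)=p(q(i))$. The pairs of coprime positive integers are the nodes of the Stern--Brocot tree: the root is $(1,1)$ with positive parent $(0,1)$ and negative parent $(1,0)$; a node $t$ with parents $t^+,t^-$ has the positive child $t_+=t+t^+$,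 with positive and negative parents $t^+$ and $t$, and the negative child $t_-=t+t^-$, with positive and negative parents $t$ and $t^-$. There are $2^k$ nodes at depth $k$. The edge from $t$ to $t_\pm$ has the label $(\sigma(t),\sigma(t_\pm),\pm)$. Let $E$ be the set of the labels that occur, and let $A$ be the matrix indexed by $E$ with $A_{ef}=1/2$ if some edge labelled $e$ is followed (at its lower end) by an edge labelled $f$, and $A_{ef}=0$ otherwise. Theorem. 1. $|E|=54$, and exactly nine orientations occur in the tree, namely those in the table below; each of them determines the end vertex as shown. 2. $A$ is a stochastic matrix (its rows sum to $1$), and the uniform distribution $\pi=\frac1{54}(1,\dots,1)$ is its unique stationary distribution. As $k\to\infty$, every entry of $A^k$ tends to $1/54$, and $\mu A^k\to\pi$ for every probability vector $\mu$ on $E$. For each label $e\in E$, the proportion of the edges from depth $k$ to depth $k+1$ that have the label $e$ tends to $1/54$. 3. As $k\to\infty$, the proportion of the nodes at depth $k$ with a given orientation $\sigma$ tends to the frequency in the table: $$\begin{array}{c|c|c} \sigma & \text{end vertex} & \text{frequency}\\ \hline 3201 & 1 & 8/54\\ 3012 & 2 & 8/54\\ 0123 & 3 & 6/54\\ 0213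 & 4 & 8/54\\ 1032 & 5 & 6/54\\ 2301 & 6 & 6/54\\ 1230 & 7 & 4/54\\ 2310 & 7 & 4/54\\ 3120 & 7 & 4/54 \end{array}$$ Consequently, the proportion of the nodes $t$ at depth $k$ with end vertex $v(t)=v$ tends to $12/54$ for $v=7$, to $8/54$ for each of $v=1,2,4$, and to $6/54$ for each of $v=3,5,6$. -/

import Mathlib

open Filter Topology
open scoped Matrix

namespace CubeGeodesic

/-! ### Rolling the cube -/

/-- One roll of the cube, in the positive `x`-direction (`r`) or the positive `y`-direction (`u`). -/
inductive Roll
  | r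
  | u
  deriving DecidableEq

/-- The eight corners of the unit cube by their coordinates `(x, y, z)` (`true` is `1`).  They serve
both as the corners of the cube in its starting position and as the eight places of a cube that
rests on a unit square of the plane, with coordinates relative to that square. -/
abbrev Corner := Bool × Bool × Bool

/-- The label `x + 2 y + 4 z` of the corner `(x, y, z)`. -/
def Corner.label (c : Corner) : Fin 8 :=
  match c with
  | (x, y, z) => (if x then 1 else 0) + (if y then 2 else 0) + (if z then 4 else 0)

/-- A placement of the cube: it tells for each place which vertex of the cube is there. -/
abbrev Placement := Corner → Corner

/-- A right roll is the quarter turn about the line `x = 1`, `z = 0`, which takes the place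
`(x, y, z)` to `(1 + z, y, 1 - x)`, that is, to the place `(z, y, 1 - x)` over the next square on
the right; an up roll is the quarter turn about `y = 1`, `z = 0`, which takes `(x, y, z)` to
`(x, 1 + z, 1 - y)`.  After the roll, a place holds the vertex that has been moved there. -/
def Placement.roll (P : Placement) : Roll → Placement
  | Roll.r => fun c => P (!c.2.2, c.2.1, c.1)
  | Roll.u => fun c => P (c.1, !c.2.2, c.2.1)

/-- The placement of the cube after a tumble sequence, read from left to right. -/
def placement (w : List Roll) : Placement := w.foldl Placement.roll id

/-- The vertex of the cube at the upper-right corner of the bottom face after a tumble sequence. -/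
def wordVertex (w : List Roll) : Fin 8 := (placement w (true, true, false)).label

/-- The permutation `1230` of the four diagonals, in one-line notation. -/
def rollR : Equiv.Perm (Fin 4) where
  toFun := ![1, 2, 3, 0]
  invFun := ![3, 0, 1, 2]
  left_inv := by decide
  right_inv := by decide

/-- The permutation `2310` of the four diagonals, in one-line notation. -/
def rollU : Equiv.Perm (Fin 4) where
  toFun := ![2, 3, 1, 0]
  invFun := ![3, 2, 0, 1]
  left_inv := by decide
  right_inv := by decide

/-- The element of `S₄` of a single roll. -/
def Roll.perm : Roll → Equiv.Perm (Fin 4)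
  | Roll.r => rollR
  | Roll.u => rollU

/-- The cube orientation of a tumble sequence, an element `σ` of `S₄`: `σ i` is the diagonal of the
cube that is in the starting position of diagonal `i` (see `diagonal_placement`). -/
def wordOrientation (w : List Roll) : Equiv.Perm (Fin 4) := (w.map Roll.perm).prod

/-- The diagonal of the cube through a vertex, named after its end in the bottom face of the
starting position: diagonal `i` joins the vertices labelled `i` and `7 - i`. -/
def Corner.diagonal (c : Corner) : Fin 4 :=
  match c with
  | (x, y, z) => (if x ^^ z then 1 else 0) + (if y ^^ z then 2 else 0)

theorem diagonal_placement (w : List Roll) (c : Corner) :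
    (placement w c).diagonal = wordOrientation w c.diagonal := by
  induction w using List.reverseRecOn generalizing c with
  | nil => simp [placement, wordOrientation]
  | append_singleton w a ih =>
    have h1 : placement (w ++ [a]) = (placement w).roll a := by simp [placement]
    have h2 : wordOrientation (w ++ [a]) = wordOrientation w * a.perm := by simp [wordOrientation]
    rw [h1, h2, Equiv.Perm.mul_apply]
    cases a
    · have h : ∀ c : Corner, Corner.diagonal (!c.2.2, c.2.1, c.1) = Roll.r.perm c.diagonal := by
        decide
      simp only [Placement.roll, ih, h]
    · have h : ∀ c : Corner, Corner.diagonal (c.1, !c.2.2, c.2.1) = Roll.u.perm c.diagonal := by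
        decide
      simp only [Placement.roll, ih, h]

/-! ### Tumble sequences of lattice segments -/

/-- The parameters `s ∈ (0, 1)` at which the point `(s a, s b)` of the segment from `(0, 0)` to
`(a, b)` is on a vertical line `x = i` or on a horizontal line `y = j` of the square grid. -/
def crossings (a b : ℕ) : Finset ℚ :=
  (Finset.Ioo 0 a).image (fun i : ℕ => (i : ℚ) / a) ∪
    (Finset.Ioo 0 b).image (fun j : ℕ => (j : ℚ) / b)

/-- The tumble sequence of a lattice point `(a, b)` visible from the origin: go along the segment
from `(0, 0)` to `(a, b)`, write `r` when it crosses a vertical line (`s a` is an integer), and `u`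
when it crosses a horizontal line. -/
def tumble (t : ℕ × ℕ) : List Roll :=
  ((crossings t.1 t.2).sort (· ≤ ·)).map (fun s : ℚ => if (s * (t.1 : ℚ)).den = 1 then Roll.r else Roll.u)

/-! ### The Stern–Brocot tree -/

/-- Signs of children and of edges in the tree. -/
inductive Sgn
  | pos
  | neg
  deriving DecidableEq

instance : Fintype Sgn where
  elems := {Sgn.pos, Sgn.neg}
  complete := by intro s; cases s <;> decide

/-- A node `t` of the Stern–Brocot tree with its positive parent `t⁺` and negative parent `t⁻`. -/
structure Node where
  pt : ℕ × ℕ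
  posParent : ℕ × ℕ
  negParent : ℕ × ℕ
  deriving DecidableEq

/-- The root `(1, 1)`. -/
def root : Node := ⟨(1, 1), (0, 1), (1, 0)⟩

/-- The positive child `t + t⁺` with parents `t⁺` and `t`, and the negative child `t + t⁻` with
parents `t` and `t⁻`. -/
def Node.child (n : Node) : Sgn → Node
  | Sgn.pos => ⟨n.pt + n.posParent, n.posParent, n.pt⟩
  | Sgn.neg => ⟨n.pt + n.negParent, n.pt, n.negParent⟩

/-- The nodes at depth `k`. -/
def level : ℕ → Finset Node
  | 0 => {root}
  | k + 1 => (level k).image (fun n => n.child Sgn.pos) ∪ (level k).image (fun n => n.child Sgn.neg)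

/-- The nodes of the tree. -/
def InTree (n : Node) : Prop := ∃ k, n ∈ level k

/-- The image of a node under a map of the plane. -/
def Node.map (φ : ℕ × ℕ → ℕ × ℕ) (n : Node) : Node := ⟨φ n.pt, φ n.posParent, φ n.negParent⟩

theorem mem_level_succ {k : ℕ} {n : Node} :
    n ∈ level (k + 1) ↔ ∃ m ∈ level k, ∃ s, n = m.child s := by
  simp only [level, Finset.mem_union, Finset.mem_image]
  constructor
  · rintro (⟨m, hm, rfl⟩ | ⟨m, hm, rfl⟩)
    exacts [⟨m, hm, Sgn.pos, rfl⟩, ⟨m, hm, Sgn.neg, rfl⟩]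
  · rintro ⟨m, hm, s, rfl⟩
    cases s
    exacts [Or.inl ⟨m, hm, rfl⟩, Or.inr ⟨m, hm, rfl⟩]

theorem child_map {φ : ℕ × ℕ → ℕ × ℕ} (hφ : ∀ p q, φ (p + q) = φ p + φ q) (n : Node) (s : Sgn) :
    (n.child s).map φ = (n.map φ).child s := by
  cases s <;> simp [Node.child, Node.map, hφ]

theorem mem_level_succ_iff_map {k : ℕ} {n : Node} :
    n ∈ level (k + 1) ↔ ∃ m ∈ level k,
      n = m.map (fun p => (p.1, p.1 + p.2)) ∨ n = m.map (fun p => (p.1 + p.2, p.2)) := by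
  have h1 : ∀ p q : ℕ × ℕ, (fun p : ℕ × ℕ => (p.1, p.1 + p.2)) (p + q) =
      (fun p : ℕ × ℕ => (p.1, p.1 + p.2)) p + (fun p : ℕ × ℕ => (p.1, p.1 + p.2)) q := by
    intro p q; ext <;> simp; omega
  have h2 : ∀ p q : ℕ × ℕ, (fun p : ℕ × ℕ => (p.1 + p.2, p.2)) (p + q) =
      (fun p : ℕ × ℕ => (p.1 + p.2, p.2)) p + (fun p : ℕ × ℕ => (p.1 + p.2, p.2)) q := by
    intro p q; ext <;> simp; omega
  induction k generalizing n with
  | zero =>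
    rw [mem_level_succ]
    simp only [level, Finset.mem_singleton, exists_eq_left]
    constructor
    · rintro ⟨s, rfl⟩
      cases s
      exacts [Or.inl rfl, Or.inr rfl]
    · rintro (rfl | rfl)
      exacts [⟨Sgn.pos, rfl⟩, ⟨Sgn.neg, rfl⟩]
  | succ k ih =>
    constructor
    · intro h
      obtain ⟨m, hm, s, rfl⟩ := mem_level_succ.1 h
      obtain ⟨l, hl, rfl | rfl⟩ := ih.1 hm
      · exact ⟨l.child s, mem_level_succ.2 ⟨l, hl, s, rfl⟩, Or.inl (child_map h1 l s).symm⟩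
      · exact ⟨l.child s, mem_level_succ.2 ⟨l, hl, s, rfl⟩, Or.inr (child_map h2 l s).symm⟩
    · rintro ⟨m, hm, h⟩
      obtain ⟨l, hl, s, rfl⟩ := mem_level_succ.1 hm
      rw [child_map h1, child_map h2] at h
      rcases h with rfl | rfl
      · exact mem_level_succ.2 ⟨_, ih.2 ⟨l, hl, Or.inl rfl⟩, s, rfl⟩
      · exact mem_level_succ.2 ⟨_, ih.2 ⟨l, hl, Or.inr rfl⟩, s, rfl⟩

theorem pos_coprime_of_mem_level {k : ℕ} {n : Node} (h : n ∈ level k) :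
    0 < n.pt.1 ∧ 0 < n.pt.2 ∧ Nat.Coprime n.pt.1 n.pt.2 := by
  induction k generalizing n with
  | zero =>
    simp only [level, Finset.mem_singleton] at h
    subst h
    decide
  | succ k ih =>
    obtain ⟨m, hm, rfl | rfl⟩ := mem_level_succ_iff_map.1 h
    · obtain ⟨h1, h2, h3⟩ := ih hm
      exact ⟨h1, Nat.add_pos_left h1 _, by simpa [Node.map] using h3⟩
    · obtain ⟨h1, h2, h3⟩ := ih hm
      exact ⟨Nat.add_pos_left h1 _, h2, by simpa [Node.map] using h3⟩

/-- The tree is a tree on the set of the visible lattice points of the first quadrant: each of them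
is the point of exactly one node, at exactly one depth. -/
theorem existsUnique_node {a b : ℕ} (ha : 0 < a) (hb : 0 < b) (hab : Nat.Coprime a b) :
    ∃! p : ℕ × Node, p.2 ∈ level p.1 ∧ p.2.pt = (a, b) := by
  induction hN : a + b using Nat.strong_induction_on generalizing a b with
  | _ N ih =>
    rcases lt_trichotomy a b with hlt | heq | hlt
    · obtain ⟨c, rfl⟩ := Nat.exists_eq_add_of_lt hlt
      obtain ⟨⟨k, n⟩, ⟨hn, hp⟩, hu⟩ := ih (a + (c + 1)) (by omega) ha (Nat.succ_pos c)
        (by simpa [add_assoc] using hab) rfl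
      refine ⟨(k + 1, n.map fun p => (p.1, p.1 + p.2)),
        ⟨mem_level_succ_iff_map.2 ⟨n, hn, Or.inl rfl⟩, ?_⟩, ?_⟩
      · simp only at hp
        simp [Node.map, hp, add_assoc]
      · rintro ⟨j, q⟩ ⟨hq, hqp⟩
        simp only at hq hqp
        cases j with
        | zero =>
          simp only [level, Finset.mem_singleton] at hq
          subst hq
          simp [root, Prod.ext_iff] at hqp
          omega
        | succ j =>
          obtain ⟨m, hm, rfl | rfl⟩ := mem_level_succ_iff_map.1 hq
          · have h := hu (j, m) ⟨hm, by
              simp only [Node.map, Prod.mk.injEq] at hqp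
              exact Prod.ext hqp.1 (by simp only; omega)⟩
            simp only [Prod.mk.injEq] at h
            rw [h.1, h.2]
          · have := (pos_coprime_of_mem_level hm).1
            simp only [Node.map, Prod.mk.injEq] at hqp
            omega
    · subst heq
      obtain rfl : a = 1 := by simpa using hab
      refine ⟨(0, root), ⟨by simp [level], rfl⟩, ?_⟩
      rintro ⟨j, q⟩ ⟨hq, hqp⟩
      simp only at hq hqp
      cases j with
      | zero =>
        simp only [level, Finset.mem_singleton] at hq
        rw [hq]
      | succ j =>
        obtain ⟨m, hm, rfl | rfl⟩ := mem_level_succ_iff_map.1 hq <;>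
        · have h := pos_coprime_of_mem_level hm
          simp only [Node.map, Prod.mk.injEq] at hqp
          omega
    · obtain ⟨c, rfl⟩ := Nat.exists_eq_add_of_lt hlt
      obtain ⟨⟨k, n⟩, ⟨hn, hp⟩, hu⟩ := ih ((c + 1) + b) (by omega) (Nat.succ_pos c) hb
        (by simpa [add_assoc] using hab) rfl
      refine ⟨(k + 1, n.map fun p => (p.1 + p.2, p.2)),
        ⟨mem_level_succ_iff_map.2 ⟨n, hn, Or.inr rfl⟩, ?_⟩, ?_⟩
      · simp only at hp
        simp [Node.map, hp]
        omega
      · rintro ⟨j, q⟩ ⟨hq, hqp⟩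
        simp only at hq hqp
        cases j with
        | zero =>
          simp only [level, Finset.mem_singleton] at hq
          subst hq
          simp [root, Prod.ext_iff] at hqp
          omega
        | succ j =>
          obtain ⟨m, hm, rfl | rfl⟩ := mem_level_succ_iff_map.1 hq
          · have := (pos_coprime_of_mem_level hm).2
            simp only [Node.map, Prod.mk.injEq] at hqp
            omega
          · have h := hu (j, m) ⟨hm, by
              simp only [Node.map, Prod.mk.injEq] at hqp
              exact Prod.ext (by simp only; omega) hqp.2⟩
            simp only [Prod.mk.injEq] at h
            rw [h.1, h.2]

/-- The cube orientation `σ(t)`. -/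
def Node.orientation (n : Node) : Equiv.Perm (Fin 4) := wordOrientation (tumble n.pt)

/-- The vertex of the cube at which the geodesic along the segment from `(0, 0)` to `t` ends. -/
def Node.endVertex (n : Node) : Fin 8 := wordVertex (tumble n.pt)

/-- The proportion of the nodes at depth `k` with a given cube orientation in one-line notation. -/
noncomputable def orientationFreq (k : ℕ) (f : Fin 4 → Fin 4) : ℝ :=
  (((level k).filter (fun n : Node => ⇑n.orientation = f)).card : ℝ) / ((level k).card : ℝ)

/-- The proportion of the nodes at depth `k` whose geodesic ends at a given vertex. -/
noncomputable def vertexFreq (k : ℕ) (v : Fin 8) : ℝ :=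
  (((level k).filter (fun n : Node => n.endVertex = v)).card : ℝ) / ((level k).card : ℝ)

/-! ### Edge labels -/

/-- Possible labels `(σ(t), σ(t₊), +)` and `(σ(t), σ(t₋), -)` of edges of the tree. -/
abbrev Label := Equiv.Perm (Fin 4) × Equiv.Perm (Fin 4) × Sgn

/-- The label of the edge from a node to its child of the given sign. -/
def Node.edgeLabel (n : Node) (s : Sgn) : Label := (n.orientation, (n.child s).orientation, s)

open Classical in
/-- The set `E` of the edge labels that occur in the tree. -/
noncomputable def edgeLabels : Finset Label :=
  Finset.univ.filter (fun e => ∃ n s, InTree n ∧ n.edgeLabel s = e)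

/-- `f` is a child of `e`: some edge with label `e` is followed by an edge with label `f`. -/
def IsChildLabel (e f : Label) : Prop :=
  ∃ n s s', InTree n ∧ n.edgeLabel s = e ∧ (n.child s).edgeLabel s' = f

open Classical in
/-- The transition matrix of the edge-label process. -/
noncomputable def transition : Matrix edgeLabels edgeLabels ℝ :=
  Matrix.of fun e f => if IsChildLabel e f then 1 / 2 else 0

/-- The proportion of the edges from depth `k` to depth `k + 1` with a given label. -/
noncomputable def edgeFreq (k : ℕ) (e : Label) : ℝ :=
  (((level k ×ˢ Finset.univ).filter (fun p : Node × Sgn => p.1.edgeLabel p.2 = e)).card : ℝ) /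
    ((level k ×ˢ (Finset.univ : Finset Sgn)).card : ℝ)

/-- The nine cube orientations in one-line notation, each with its end vertex and with the
numerator of its frequency over the denominator `54`. -/
def orientationTable : List ((Fin 4 → Fin 4) × Fin 8 × ℕ) :=
  [(![3, 2, 0, 1], 1, 8),
   (![3, 0, 1, 2], 2, 8),
   (![0, 1, 2, 3], 3, 6),
   (![0, 2, 1, 3], 4, 8),
   (![1, 0, 3, 2], 5, 6),
   (![2, 3, 0, 1], 6, 6),
   (![1, 2, 3, 0], 7, 4),
   (![2, 3, 1, 0], 7, 4),
   (![3, 1, 2, 0], 7, 4)]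

end CubeGeodesic

open CubeGeodesic

/-! A tumble sequence is not the concatenation of those of the parents, but it becomes
multiplicative after padding. The lattice path hugging the segment from above is `u`, then the
tumble sequence, then `r` (`stairs_eq_tumble`). The parents p = t⁺ and q = t⁻ have determinant one
and p is the steeper one, so the triangle 0, p, p + q contains no further lattice point. Hence the
path to p + q passes through p and splits into the paths to p and to q (`stairs_add`).

Let P and Q be the elements of S₄ of the paths to the two parents. The node has orientation
u⁻¹PQr⁻¹, and its children have the pairs (P, PQ) and (PQ, Q). So the tree is driven by a finite
automaton on S₄ × S₄. From (u, r) it reaches just 27 pairs (`step_stateOf`), and each sign permutes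
them (`next_injective`). By cancellation a label is the same as a state with a sign
(`State.eq_of_orientation_eq`), whence 54 = 27 · 2 labels.

Since both signs act by permutations, the transition matrix is doubly stochastic and the uniform
distribution is stationary. State 0 can be reached from every state in the same number of steps, so
a power of the matrix has a positive column. This gives an ℓ¹ contraction on vectors of mass zero,
hence uniqueness and convergence (`tendsto_vecMul_pow_zero`). The edge proportions obey exactly the
same recursion (`edgeFreq_succ`). Every state thus gets limiting weight 1/27, and the table counts
states by orientation. The end vertex is read off the orientation: σ(3) is its diagonal, and the
sign of σ selects the end of it. -/

namespace CubeGeodesic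

/-! ### The upper staircase below a lattice segment -/

/-- `n` steps, starting at `(i, j)`, of the lattice path that goes right (`r`) whenever this keeps it
weakly above the line from the origin to `(a, b)`, and goes up (`u`) otherwise. -/
def walk (a b : ℕ) : ℕ → ℕ → ℕ → List Roll
  | 0, _, _ => []
  | n + 1, i, j => if (i + 1) * b ≤ j * a then Roll.r :: walk a b n (i + 1) j
      else Roll.u :: walk a b n i (j + 1)

/-- The staircase from the origin to `t`. -/
def stairs (t : ℕ × ℕ) : List Roll := walk t.1 t.2 (t.1 + t.2) 0 0

/-- Up to (c, d), the walks towards (c, d) and towards (c, d) + (a, b) make the same decisions: by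
unimodularity, no lattice point that they test separates the two lines. -/
theorem walk_add_first {a b c d : ℕ} (h : a * d = b * c + 1) (m : ℕ) :
    ∀ n i j : ℕ, i ≤ c → j ≤ d → i + j + n = c + d →
      walk (c + a) (d + b) (n + m) i j = walk c d n i j ++ walk (c + a) (d + b) m c d := by
  intro n
  induction n with
  | zero =>
    intro i j hi hj hn
    obtain rfl : i = c := by omega
    obtain rfl : j = d := by omega
    simp [walk]
  | succ n ih =>
    intro i j hi hj hn
    have hd : 0 < d := by
      rcases Nat.eq_zero_or_pos d with rfl | h'
      · simp at h
      · exact h'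
    have key : (i + 1) * (d + b) ≤ j * (c + a) ↔ (i + 1) * d ≤ j * c := by
      -- Put D = jc − (i+1)d and D' = ja − (i+1)b. This is dD' = bD + j, while the longer walk tests
      -- D + D' ≥ 0 and the shorter one D ≥ 0.
      have e : d * (j * a) + b * ((i + 1) * d) = d * ((i + 1) * b) + b * (j * c) + j := by
        have : d * (j * a) = j * (b * c + 1) := by rw [← h]; ring
        rw [this]; ring
      constructor
      · intro h1
        by_contra! h2
        -- For b = 0 the bound j ≤ d alone does not exclude j = d, the height of (c, d) + (a, b);
        -- there the remaining length gives i + 1 ≤ c.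
        rcases Nat.eq_zero_or_pos b with rfl | hb
        · rcases hj.lt_or_eq with h3 | rfl
          · have : d * (j * a) = j := by simpa using e
            have h4 : j * a = 0 := by
              by_contra h5
              have : d * 1 ≤ d * (j * a) := Nat.mul_le_mul_left _ (by omega)
              omega
            nlinarith
          · have : i + 1 ≤ c := by omega
            nlinarith
        · have h3 : (i + 1) * b + 1 ≤ j * a := by nlinarith
          nlinarith
      · intro h1
        have h2 : d * ((i + 1) * b) ≤ d * (j * a) := by nlinarith
        have h3 := Nat.le_of_mul_le_mul_left h2 hd
        nlinarith
    rw [show n + 1 + m = (n + m) + 1 by ring]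
    simp only [walk, key]
    split_ifs with h1
    · rw [ih (i + 1) j _ hj (by omega)]
      · rfl
      · by_contra! h2
        obtain rfl : i = c := by omega
        have : j + 1 ≤ d := by omega
        nlinarith
    · rw [ih i (j + 1) hi _ (by omega)]
      · rfl
      · by_contra! h2
        obtain rfl : j = d := by omega
        apply h1
        rw [mul_comm]
        exact Nat.mul_le_mul_left _ (by omega)

/-- After (c, d) the rest of the walk is a translate of the walk towards (a, b), again because no
lattice point tested separates the two lines. -/
theorem walk_add_second {a b c d : ℕ} (h : a * d = b * c + 1) :
    ∀ n i j : ℕ, i ≤ a → j ≤ b → i + j + n = a + b →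
      walk (c + a) (d + b) n (c + i) (d + j) = walk a b n i j := by
  intro n
  induction n with
  | zero => intros; rfl
  | succ n ih =>
    intro i j hi hj hn
    have ha : 0 < a := by
      rcases Nat.eq_zero_or_pos a with rfl | h'
      · simp at h
      · exact h'
    have e : a * (j * c) + (i + 1) + c * ((i + 1) * b) = a * ((i + 1) * d) + c * (j * a) := by
      have : a * ((i + 1) * d) = (i + 1) * (b * c + 1) := by rw [← h]; ring
      rw [this]; ring
    have key : (c + i + 1) * (d + b) ≤ (d + j) * (c + a) ↔ (i + 1) * b ≤ j * a := by
      -- The extra 1 is the determinant ad − bc: the starting point (c, d) is that far above the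
      -- line to (c, d) + (a, b).
      have e' : (c + i + 1) * (d + b) ≤ (d + j) * (c + a) ↔
          (i + 1) * d + (i + 1) * b ≤ j * c + j * a + 1 := by
        constructor <;> intro h' <;> nlinarith
      rw [e']
      constructor
      · intro h1
        by_contra! h2
        have h3 : a * (j * c) < a * ((i + 1) * d) := by nlinarith
        have h4 := Nat.lt_of_mul_lt_mul_left h3
        omega
      · intro h1
        have hia : i + 1 ≤ a := by
          by_contra! h2
          obtain rfl : i = a := by omega
          have : j + 1 ≤ b := by omega
          nlinarith
        have h3 : a * ((i + 1) * d) ≤ a * (j * c + 1) := by nlinarith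
        have h4 := Nat.le_of_mul_le_mul_left h3 ha
        omega
    simp only [walk, key]
    split_ifs with h1
    · rw [add_assoc c, ih (i + 1) j _ hj (by omega)]
      by_contra! h2
      obtain rfl : i = a := by omega
      have : j + 1 ≤ b := by omega
      nlinarith
    · rw [add_assoc d, ih i (j + 1) hi _ (by omega)]
      by_contra! h2
      obtain rfl : j = b := by omega
      apply h1
      rw [mul_comm]
      exact Nat.mul_le_mul_left _ (by omega)

theorem stairs_add {p q : ℕ × ℕ} (h : q.1 * p.2 = q.2 * p.1 + 1) :
    stairs (p + q) = stairs p ++ stairs q := by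
  simp only [stairs, Prod.fst_add, Prod.snd_add]
  rw [show p.1 + q.1 + (p.2 + q.2) = (p.1 + p.2) + (q.1 + q.2) by ring,
    walk_add_first h _ _ 0 0 (Nat.zero_le _) (Nat.zero_le _) (by omega)]
  congr 1
  exact walk_add_second h (q.1 + q.2) 0 0 (Nat.zero_le _) (Nat.zero_le _) (by omega)

/-! ### The staircase and the tumble sequence -/

/-- The crossings of the segment to `(a, b)` after `i` vertical and `j` horizontal lines. -/
def laterCrossings (a b i j : ℕ) : Finset ℚ :=
  (Finset.Ioo i a).image (fun i : ℕ => (i : ℚ) / a) ∪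
    (Finset.Ioo j b).image (fun j : ℕ => (j : ℚ) / b)

/-- The letter of a crossing of the segment to `(a, b)`. -/
def crossingLetter (a : ℕ) (s : ℚ) : Roll := if (s * (a : ℚ)).den = 1 then Roll.r else Roll.u

theorem crossingLetter_vertical {a : ℕ} (ha : 0 < a) (i : ℕ) :
    crossingLetter a ((i : ℚ) / a) = Roll.r := by
  have : (a : ℚ) ≠ 0 := by positivity
  rw [crossingLetter, div_mul_cancel₀ _ this, if_pos (Rat.den_natCast i)]

theorem crossingLetter_horizontal {a b : ℕ} (hab : Nat.Coprime a b) {j : ℕ} (h0 : 0 < j)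
    (hj : j < b) : crossingLetter a ((j : ℚ) / b) = Roll.u := by
  have hb : (b : ℚ) ≠ 0 := by have : 0 < b := by omega
                              positivity
  rw [crossingLetter, if_neg]
  intro h
  have h1 : (((j : ℚ) / b * a).num : ℚ) = (j : ℚ) / b * a := (Rat.den_eq_one_iff _).1 h
  have h2 : (((j : ℚ) / b * a).num * b : ℚ) = j * a := by rw [h1]; field_simp
  have h3 : (((j : ℚ) / b * a).num * b : ℤ) = j * a := by exact_mod_cast h2
  have h4 : (b : ℤ) ∣ (j * a : ℕ) := ⟨_, by push_cast; rw [← h3]; ring⟩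
  have h5 : b ∣ j := (Nat.Coprime.symm hab).dvd_of_dvd_mul_right (Int.natCast_dvd_natCast.1 h4)
  exact absurd (Nat.le_of_dvd h0 h5) (by omega)

theorem Ioo_eq_insert_succ {i a : ℕ} (h : i + 1 < a) :
    Finset.Ioo i a = insert (i + 1) (Finset.Ioo (i + 1) a) := by
  ext x; simp; omega

theorem sort_insert_of_lt {s : Finset ℚ} {x : ℚ} (h : ∀ y ∈ s, x < y) :
    (insert x s).sort (· ≤ ·) = x :: s.sort (· ≤ ·) :=
  Finset.sort_insert (r := (· ≤ ·)) (fun y hy => (h y hy).le) (fun hx => lt_irrefl _ (h x hx))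

/-- After i vertical and j horizontal crossings the segment is in the square with upper-left corner
(i, j + 1), where the walk then is. The walk's test compares the next crossing parameters (i + 1)/a
and (j + 1)/b. The final `r` leads from (a − 1, b) to (a, b). -/
theorem walk_eq_map_sort {a b : ℕ} (hab : Nat.Coprime a b) (ha : 0 < a) (hb : 0 < b) :
    ∀ n i j : ℕ, i < a → j < b → i + j + n + 2 = a + b →
      walk a b (n + 1) i (j + 1) =
        ((laterCrossings a b i j).sort (· ≤ ·)).map (crossingLetter a) ++ [Roll.r] := by
  have ha' : (0 : ℚ) < a := by positivity
  have hb' : (0 : ℚ) < b := by positivity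
  intro n
  induction n with
  | zero =>
    intro i j hi hj hn
    obtain rfl : a = i + 1 := by omega
    obtain rfl : b = j + 1 := by omega
    have h0 : ∀ k, Finset.Ioo k (k + 1) = ∅ := by intro k; ext x; simp
    simpa [walk, laterCrossings, h0] using (mul_comm _ _).le
  | succ n ih =>
    intro i j hi hj hn
    rw [walk]
    split_ifs with h1
    · have hi' : i + 1 < a := by
        by_contra! h2
        obtain rfl : a = i + 1 := by omega
        have : j + 1 < b := by omega
        nlinarith
      rw [ih (i + 1) j hi' hj (by omega)]
      have h2 : laterCrossings a b i j =
          insert (((i + 1 : ℕ) : ℚ) / a) (laterCrossings a b (i + 1) j) := by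
        rw [laterCrossings, Ioo_eq_insert_succ hi', Finset.image_insert, Finset.insert_union]
        rfl
      rw [h2, sort_insert_of_lt, List.map_cons, crossingLetter_vertical ha, List.cons_append]
      intro y hy
      simp only [laterCrossings, Finset.mem_union, Finset.mem_image, Finset.mem_Ioo] at hy
      rcases hy with ⟨k, ⟨hk, -⟩, rfl⟩ | ⟨k, ⟨hk, hkb⟩, rfl⟩
      · rw [div_lt_div_iff_of_pos_right ha']
        exact_mod_cast hk
      · rw [div_lt_div_iff₀ ha' hb']
        have h3 : (i + 1) * b ≤ k * a := h1.trans (Nat.mul_le_mul_right _ hk)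
        -- A tie would be an interior lattice point of the segment, which coprimality excludes.
        have h4 : (i + 1) * b ≠ k * a := by
          intro h5
          have h6 : a ∣ i + 1 := hab.dvd_of_dvd_mul_right ⟨k, by rw [h5, mul_comm]⟩
          exact absurd (Nat.le_of_dvd (Nat.succ_pos i) h6) (by omega)
        exact_mod_cast lt_of_le_of_ne h3 h4
    · have hj' : j + 1 < b := by
        by_contra! h2
        obtain rfl : b = j + 1 := by omega
        apply h1
        rw [mul_comm]
        exact Nat.mul_le_mul_left _ (by omega)
      rw [ih i (j + 1) hi hj' (by omega)]
      have h2 : laterCrossings a b i j =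
          insert (((j + 1 : ℕ) : ℚ) / b) (laterCrossings a b i (j + 1)) := by
        rw [laterCrossings, Ioo_eq_insert_succ hj', Finset.image_insert, Finset.union_insert]
        rfl
      rw [h2, sort_insert_of_lt, List.map_cons,
        crossingLetter_horizontal hab (Nat.succ_pos j) hj', List.cons_append]
      intro y hy
      simp only [laterCrossings, Finset.mem_union, Finset.mem_image, Finset.mem_Ioo] at hy
      rcases hy with ⟨k, ⟨hk, -⟩, rfl⟩ | ⟨k, ⟨hk, hkb⟩, rfl⟩
      · rw [div_lt_div_iff₀ hb' ha']
        have h3 : (j + 1) * a < k * b := by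
          push Not at h1
          exact h1.trans_le (Nat.mul_le_mul_right _ hk)
        exact_mod_cast h3
      · rw [div_lt_div_iff_of_pos_right hb']
        exact_mod_cast hk

/-- The tumble sequence is the staircase without its first and last steps. -/
theorem stairs_eq_tumble {t : ℕ × ℕ} (h1 : 0 < t.1) (h2 : 0 < t.2) (h : Nat.Coprime t.1 t.2) :
    stairs t = Roll.u :: (tumble t ++ [Roll.r]) := by
  obtain ⟨n, hn⟩ : ∃ n, t.1 + t.2 = n + 2 := ⟨t.1 + t.2 - 2, by omega⟩
  rw [stairs, hn, walk, if_neg (by simp; omega),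
    walk_eq_map_sort h h1 h2 n 0 0 h1 h2 (by omega)]
  rfl

/-- The element of `S₄` of the staircase. -/
def stairsPerm (t : ℕ × ℕ) : Equiv.Perm (Fin 4) := wordOrientation (stairs t)

theorem wordOrientation_append (v w : List Roll) :
    wordOrientation (v ++ w) = wordOrientation v * wordOrientation w := by
  simp [wordOrientation]

theorem wordOrientation_tumble {t : ℕ × ℕ} (h1 : 0 < t.1) (h2 : 0 < t.2)
    (h : Nat.Coprime t.1 t.2) :
    wordOrientation (tumble t) = rollU⁻¹ * stairsPerm t * rollR⁻¹ := by
  rw [stairsPerm, stairs_eq_tumble h1 h2 h]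
  simp [wordOrientation, Roll.perm, mul_assoc]

/-! ### The end vertex -/

/-- The parity of `x + y + z`. -/
def Corner.parity (c : Corner) : Bool := c.1 ^^ c.2.1 ^^ c.2.2

/-- A roll changes the parity of every place, and its permutation of the diagonals is a 4-cycle,
hence odd. -/
theorem parity_placement (w : List Roll) (c : Corner) :
    (placement w c).parity = (c.parity ^^ decide (Equiv.Perm.sign (wordOrientation w) = -1)) := by
  induction w using List.reverseRecOn generalizing c with
  | nil => simp [placement, wordOrientation]
  | append_singleton w a ih =>
    have h1 : placement (w ++ [a]) = (placement w).roll a := by simp [placement]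
    have h2 : wordOrientation (w ++ [a]) = wordOrientation w * a.perm := by simp [wordOrientation]
    have h3 : Equiv.Perm.sign a.perm = -1 := by cases a <;> decide
    have h4 : (placement w).roll a c = placement w (Placement.roll id a c) := by cases a <;> rfl
    have h5 : ∀ c : Corner, (Placement.roll id a c).parity = !c.parity := by
      cases a <;> decide
    rw [h1, h2, h4, ih, h5, map_mul, h3]
    rcases Int.units_eq_one_or (Equiv.Perm.sign (wordOrientation w)) with h | h <;> simp [h]

/-- The two ends of a diagonal differ in all three coordinates, so they have opposite parities. -/
theorem label_eq_of_diagonal_eq {c c' : Corner} (h : c.diagonal = c'.diagonal)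
    (h' : c.parity = c'.parity) : c = c' := by
  revert c c'; decide

theorem wordVertex_eq {w : List Roll} {c : Corner} (h : c.diagonal = wordOrientation w 3)
    (h' : c.parity = decide (Equiv.Perm.sign (wordOrientation w) = -1)) :
    wordVertex w = c.label := by
  have h1 : (placement w (true, true, false)).diagonal = c.diagonal := by
    rw [diagonal_placement, h]; rfl
  have h2 : (placement w (true, true, false)).parity = c.parity := by
    rw [parity_placement, h']; simp [Corner.parity]
  rw [wordVertex, label_eq_of_diagonal_eq h1 h2]

/-! ### Convergence of a doubly stochastic matrix with a Doeblin condition -/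

section Doeblin

variable {ι : Type*} [Fintype ι]

theorem sum_vecMul_of_row_sum {A : Matrix ι ι ℝ} {c : ℝ} (h : ∀ i, ∑ j, A i j = c) (μ : ι → ℝ) :
    ∑ j, (μ ᵥ* A) j = (∑ i, μ i) * c := by
  simp only [Matrix.vecMul, dotProduct]
  rw [Finset.sum_comm, Finset.sum_mul]
  exact Finset.sum_congr rfl fun i _ => by rw [← Finset.mul_sum, h]

theorem sum_abs_vecMul_le {A : Matrix ι ι ℝ} {c : ℝ} (h0 : ∀ i j, 0 ≤ A i j)
    (h : ∀ i, ∑ j, A i j = c) (μ : ι → ℝ) :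
    ∑ j, |(μ ᵥ* A) j| ≤ (∑ i, |μ i|) * c := by
  rw [← sum_vecMul_of_row_sum h fun i => |μ i|]
  refine Finset.sum_le_sum fun j _ => ?_
  simp only [Matrix.vecMul, dotProduct]
  refine (Finset.abs_sum_le_sum_abs _ _).trans (Finset.sum_le_sum fun i _ => ?_)
  rw [abs_mul, abs_of_nonneg (h0 i j)]

variable [DecidableEq ι]

theorem pow_nonneg_apply {A : Matrix ι ι ℝ} (h0 : ∀ i j, 0 ≤ A i j) (k : ℕ) :
    ∀ i j, 0 ≤ (A ^ k) i j := by
  induction k with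
  | zero => intro i j; rw [pow_zero, Matrix.one_apply]; split_ifs <;> norm_num
  | succ k ih =>
    intro i j
    rw [pow_succ, Matrix.mul_apply]
    exact Finset.sum_nonneg fun l _ => mul_nonneg (ih i l) (h0 l j)

theorem sum_vecMul_pow {A : Matrix ι ι ℝ} (h1 : ∀ i, ∑ j, A i j = 1) (μ : ι → ℝ) (k : ℕ) :
    ∑ j, (μ ᵥ* A ^ k) j = ∑ i, μ i := by
  induction k with
  | zero => simp
  | succ k ih => rw [pow_succ, ← Matrix.vecMul_vecMul, sum_vecMul_of_row_sum h1, ih, mul_one]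

theorem row_sum_pow {A : Matrix ι ι ℝ} (h1 : ∀ i, ∑ j, A i j = 1) (k : ℕ) (i : ι) :
    ∑ j, (A ^ k) i j = 1 := by
  have := sum_vecMul_pow h1 (Pi.single i 1) k
  simpa using this

/-- The `ℓ¹` contraction: if column `o` of `A ^ K` is positive, then `μ A ^ k → 0` for every `μ`
of total mass `0`. -/
theorem tendsto_vecMul_pow_zero {A : Matrix ι ι ℝ} (h0 : ∀ i j, 0 ≤ A i j)
    (h1 : ∀ i, ∑ j, A i j = 1) {K : ℕ} {o : ι} (hK : ∀ i, 0 < (A ^ K) i o)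
    {μ : ι → ℝ} (hμ : ∑ i, μ i = 0) : Tendsto (fun k : ℕ => μ ᵥ* A ^ k) atTop (𝓝 0) := by
  obtain ⟨i₀, -, hi₀⟩ := Finset.exists_min_image Finset.univ (fun i => (A ^ K) i o)
    ⟨o, Finset.mem_univ o⟩
  set δ := (A ^ K) i₀ o with hδ
  have hδ0 : 0 < δ := hK i₀
  have step : ∀ ν : ι → ℝ, ∑ i, ν i = 0 →
      ∑ j, |(ν ᵥ* A ^ K) j| ≤ (∑ i, |ν i|) * (1 - δ) := by
    intro ν hν
    -- Removing δ from column `o` keeps the entries nonnegative, lowers the row sums to 1 − δ, and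
    -- does not change the action on vectors of mass zero.
    set B : Matrix ι ι ℝ := A ^ K - Matrix.of fun _ j => (Pi.single o δ : ι → ℝ) j with hB
    have hB0 : ∀ i j, 0 ≤ B i j := by
      intro i j
      rw [hB, Matrix.sub_apply, Matrix.of_apply]
      by_cases hj : j = o
      · subst hj
        rw [Pi.single_eq_same]
        exact sub_nonneg.2 (hi₀ i (Finset.mem_univ i))
      · rw [Pi.single_eq_of_ne hj, sub_zero]
        exact pow_nonneg_apply h0 K i j
    have hB1 : ∀ i, ∑ j, B i j = 1 - δ := by
      intro i
      simp only [hB, Matrix.sub_apply, Matrix.of_apply, Finset.sum_sub_distrib, row_sum_pow h1]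
      simp
    have hνB : ν ᵥ* A ^ K = ν ᵥ* B := by
      ext j
      rw [hB, Matrix.vecMul_sub, Pi.sub_apply]
      simp only [Matrix.vecMul, dotProduct, Matrix.of_apply]
      rw [← Finset.sum_mul, hν, zero_mul, sub_zero]
    rw [hνB]
    exact sum_abs_vecMul_le hB0 hB1 ν
  set N : ℕ → ℝ := fun k => ∑ j, |(μ ᵥ* A ^ k) j| with hN
  have hN0 : ∀ k, 0 ≤ N k := fun k => Finset.sum_nonneg fun _ _ => abs_nonneg _
  have hanti : Antitone N := antitone_nat_of_succ_le fun k => by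
    have := sum_abs_vecMul_le h0 h1 (μ ᵥ* A ^ k)
    rwa [Matrix.vecMul_vecMul, ← pow_succ, mul_one] at this
  have hlim := tendsto_atTop_ciInf hanti ⟨0, by rintro _ ⟨k, rfl⟩; exact hN0 k⟩
  set l := ⨅ k, N k
  have hl0 : 0 ≤ l := ge_of_tendsto' hlim hN0
  -- The nonincreasing norms have a limit l, and the contraction over K steps passes to it.
  have hl1 : l ≤ l * (1 - δ) := by
    refine le_of_tendsto_of_tendsto' ((tendsto_add_atTop_iff_nat K).2 hlim) (hlim.mul_const _) ?_
    intro k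
    have := step (μ ᵥ* A ^ k) (by rw [sum_vecMul_pow h1, hμ])
    rwa [Matrix.vecMul_vecMul, ← pow_add] at this
  have hl : l = 0 := by nlinarith
  rw [hl] at hlim
  rw [tendsto_pi_nhds]
  intro j
  refine squeeze_zero_norm (fun k => ?_) hlim
  exact Finset.single_le_sum (f := fun j => |(μ ᵥ* A ^ k) j|) (fun _ _ => abs_nonneg _)
    (Finset.mem_univ j)

theorem vecMul_pow_eq_self {A : Matrix ι ι ℝ} {μ : ι → ℝ} (h : μ ᵥ* A = μ) (k : ℕ) :
    μ ᵥ* A ^ k = μ := by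
  induction k with
  | zero => simp
  | succ k ih => rw [pow_succ, ← Matrix.vecMul_vecMul, ih, h]

theorem tendsto_vecMul_pow {A : Matrix ι ι ℝ} (h0 : ∀ i j, 0 ≤ A i j)
    (h1 : ∀ i, ∑ j, A i j = 1) {K : ℕ} {o : ι} (hK : ∀ i, 0 < (A ^ K) i o)
    {π : ι → ℝ} (hπ : ∑ i, π i = 1) (hπA : π ᵥ* A = π)
    {μ : ι → ℝ} (hμ : ∑ i, μ i = 1) : Tendsto (fun k : ℕ => μ ᵥ* A ^ k) atTop (𝓝 π) := by
  have := (tendsto_vecMul_pow_zero h0 h1 hK (μ := μ - π)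
    (by simp [Finset.sum_sub_distrib, hμ, hπ])).add_const π
  simpa [Matrix.sub_vecMul, vecMul_pow_eq_self hπA] using this

theorem tendsto_pow_of_doeblin {A : Matrix ι ι ℝ} (h0 : ∀ i j, 0 ≤ A i j)
    (h1 : ∀ i, ∑ j, A i j = 1) {K : ℕ} {o : ι} (hK : ∀ i, 0 < (A ^ K) i o)
    {π : ι → ℝ} (hπ : ∑ i, π i = 1) (hπA : π ᵥ* A = π) :
    Tendsto (fun k : ℕ => A ^ k) atTop (𝓝 (Matrix.of fun _ => π)) := by
  refine tendsto_pi_nhds.2 fun i => ?_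
  have := tendsto_vecMul_pow h0 h1 hK hπ hπA (μ := Pi.single i 1) (by simp)
  refine this.congr fun k => ?_
  rw [Matrix.single_one_vecMul]
  rfl

theorem vecMul_eq_self_iff_of_doeblin {A : Matrix ι ι ℝ} (h0 : ∀ i j, 0 ≤ A i j)
    (h1 : ∀ i, ∑ j, A i j = 1) {K : ℕ} {o : ι} (hK : ∀ i, 0 < (A ^ K) i o)
    {π : ι → ℝ} (hπ : ∑ i, π i = 1) (hπA : π ᵥ* A = π)
    {μ : ι → ℝ} (hμ : ∑ i, μ i = 1) : μ ᵥ* A = μ ↔ μ = π := by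
  refine ⟨fun h => ?_, fun h => by rw [h, hπA]⟩
  have := tendsto_vecMul_pow h0 h1 hK hπ hπA hμ
  simp only [vecMul_pow_eq_self h] at this
  exact tendsto_nhds_unique tendsto_const_nhds this

end Doeblin

/-! ### The state of a node -/

/-- The elements of `S₄` of the staircases to the positive and the negative parent of a node. -/
abbrev State := Equiv.Perm (Fin 4) × Equiv.Perm (Fin 4)

/-- The state of the child of a node. -/
def State.step (s : State) : Sgn → State
  | Sgn.pos => (s.1, s.1 * s.2)
  | Sgn.neg => (s.1 * s.2, s.2)

/-- The orientation of a node. -/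
def State.orientation (s : State) : Equiv.Perm (Fin 4) := rollU⁻¹ * (s.1 * s.2) * rollR⁻¹

/-- The state of a node. -/
def Node.state (n : Node) : State := (stairsPerm n.posParent, stairsPerm n.negParent)

theorem inTree_root : InTree root := ⟨0, by simp [level]⟩

theorem InTree.child {n : Node} (h : InTree n) (x : Sgn) : InTree (n.child x) := by
  obtain ⟨k, hk⟩ := h
  exact ⟨k + 1, mem_level_succ.2 ⟨n, hk, x, rfl⟩⟩

theorem InTree.induction {p : Node → Prop} (h0 : p root)
    (h1 : ∀ n x, InTree n → p n → p (n.child x)) {n : Node} (h : InTree n) : p n := by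
  obtain ⟨k, hk⟩ := h
  induction k generalizing n with
  | zero =>
    simp only [level, Finset.mem_singleton] at hk
    rwa [hk]
  | succ k ih =>
    obtain ⟨m, hm, x, rfl⟩ := mem_level_succ.1 hk
    exact h1 m x ⟨k, hm⟩ (ih hm)

/-- The determinant of the parents is preserved when one of them is replaced by their sum; it is the
hypothesis of `stairs_add`. -/
theorem InTree.parents {n : Node} (h : InTree n) :
    n.pt = n.posParent + n.negParent ∧
      n.negParent.1 * n.posParent.2 = n.negParent.2 * n.posParent.1 + 1 := by
  refine InTree.induction (p := fun n => n.pt = n.posParent + n.negParent ∧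
    n.negParent.1 * n.posParent.2 = n.negParent.2 * n.posParent.1 + 1)
    ⟨rfl, rfl⟩ (fun m x _ ⟨h1, h2⟩ => ?_) h
  cases x
  · refine ⟨by simp [Node.child, add_comm], ?_⟩
    simp only [Node.child, h1, Prod.fst_add, Prod.snd_add]
    nlinarith
  · refine ⟨by simp [Node.child], ?_⟩
    simp only [Node.child, h1, Prod.fst_add, Prod.snd_add]
    nlinarith

theorem InTree.stairsPerm_pt {n : Node} (h : InTree n) :
    stairsPerm n.pt = n.state.1 * n.state.2 := by
  rw [h.parents.1, stairsPerm, stairs_add h.parents.2, wordOrientation_append]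
  rfl

theorem InTree.orientation_eq {n : Node} (h : InTree n) :
    n.orientation = n.state.orientation := by
  obtain ⟨k, hk⟩ := h
  obtain ⟨h1, h2, h3⟩ := pos_coprime_of_mem_level hk
  rw [Node.orientation, wordOrientation_tumble h1 h2 h3, InTree.stairsPerm_pt ⟨k, hk⟩]
  rfl

theorem InTree.state_child {n : Node} (h : InTree n) (x : Sgn) :
    (n.child x).state = n.state.step x := by
  cases x <;> simp [Node.child, Node.state, State.step, h.stairsPerm_pt]

/-- The first orientation gives PQ, the second one P·PQ or PQ·Q; cancellation recovers P and Q. -/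
theorem State.eq_of_orientation_eq {s s' : State} {x : Sgn} (h : s.orientation = s'.orientation)
    (h' : (s.step x).orientation = (s'.step x).orientation) : s = s' := by
  have h1 : s.1 * s.2 = s'.1 * s'.2 := mul_left_cancel (mul_right_cancel h)
  have h2 : (s.step x).1 * (s.step x).2 = (s'.step x).1 * (s'.step x).2 :=
    mul_left_cancel (mul_right_cancel h')
  cases x
  · simp only [State.step, h1] at h2
    have h3 := mul_right_cancel h2
    rw [h3] at h1
    exact Prod.ext h3 (mul_left_cancel h1)
  · simp only [State.step, h1] at h2
    have h3 := mul_left_cancel h2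
    rw [h3] at h1
    exact Prod.ext (mul_right_cancel h1) h3

/-! ### The 27 states -/

/-- A path from the root to a node of each of the 27 states. -/
def statePath : Fin 27 → List Sgn :=
  ![[], [.pos], [.neg], [.pos, .pos],
    [.pos, .neg], [.neg, .pos], [.neg, .neg], [.pos, .pos, .pos],
    [.pos, .pos, .neg], [.pos, .neg, .pos], [.pos, .neg, .neg], [.neg, .pos, .pos],
    [.neg, .pos, .neg], [.neg, .neg, .pos], [.neg, .neg, .neg], [.pos, .pos, .pos, .neg],
    [.pos, .pos, .neg, .pos], [.pos, .neg, .neg, .pos], [.neg, .pos, .pos, .neg], [.neg, .neg, .pos, .neg],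
    [.neg, .neg, .neg, .pos], [.pos, .pos, .pos, .neg, .pos], [.pos, .pos, .pos, .neg, .neg], [.pos, .pos, .neg, .pos, .pos],
    [.pos, .neg, .neg, .pos, .pos], [.neg, .neg, .neg, .pos, .pos], [.neg, .neg, .neg, .pos, .neg]]

/-- The states that occur in the tree. -/
def stateOf (i : Fin 27) : State := (statePath i).foldl State.step (rollU, rollR)

/-- The numbers of the states of the children. -/
def next : Sgn → Fin 27 → Fin 27
  | Sgn.pos => ![1, 3, 5, 7, 9, 11, 13, 0, 16, 4, 17, 2, 10, 6, 20, 21, 23, 24, 15, 18, 25, 19, 26, 8, 12, 14, 22]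
  | Sgn.neg => ![2, 4, 6, 8, 10, 12, 14, 15, 3, 11, 1, 18, 5, 19, 0, 22, 17, 20, 23, 24, 26, 25, 7, 9, 13, 21, 16]

/-- The list is closed under both steps, so no further state occurs. -/
theorem step_stateOf : ∀ (i : Fin 27) (x : Sgn), (stateOf i).step x = stateOf (next x i) := by
  decide +kernel

theorem stateOf_injective : Function.Injective stateOf := by
  have : ∀ i j : Fin 27, stateOf i = stateOf j → i = j := by decide +kernel
  exact this

/-- P and Q can be recovered from (P, PQ) and from (PQ, Q). This invertibility is what makes the
uniform distribution stationary. -/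
theorem next_injective (x : Sgn) : Function.Injective (next x) := by
  have : ∀ (x : Sgn) (i j : Fin 27), next x i = next x j → i = j := by decide +kernel
  exact this x

theorem next_bijective (x : Sgn) : Function.Bijective (next x) :=
  Finite.injective_iff_bijective.1 (next_injective x)

/-- State `0` is reached from every state in exactly six steps. -/
theorem exists_path_to_zero (i : Fin 27) :
    ∃ w : List Sgn, w.length = 6 ∧ w.foldl (fun i x => next x i) i = 0 := by
  have : ∀ i : Fin 27, ∃ a b c d e f : Sgn,
      [a, b, c, d, e, f].foldl (fun i x => next x i) i = 0 := by decide +kernel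
  obtain ⟨a, b, c, d, e, f, h⟩ := this i
  exact ⟨_, rfl, h⟩

theorem InTree.exists_state {n : Node} (h : InTree n) : ∃ i, n.state = stateOf i := by
  refine InTree.induction (p := fun n => ∃ i, n.state = stateOf i) ⟨0, by decide +kernel⟩ ?_ h
  rintro m x hm ⟨i, hi⟩
  exact ⟨next x i, by rw [hm.state_child, hi, step_stateOf]⟩

theorem exists_inTree_state (i : Fin 27) : ∃ n, InTree n ∧ n.state = stateOf i := by
  have : ∀ (w : List Sgn) (m : Node), InTree m →
      InTree (w.foldl Node.child m) ∧
        (w.foldl Node.child m).state = w.foldl State.step m.state := by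
    intro w
    induction w with
    | nil => exact fun m hm => ⟨hm, rfl⟩
    | cons x w ih =>
      intro m hm
      have := ih (m.child x) (hm.child x)
      rwa [hm.state_child] at this
  obtain ⟨h1, h2⟩ := this (statePath i) root inTree_root
  exact ⟨_, h1, by rw [h2, show root.state = (rollU, rollR) by decide +kernel]; rfl⟩

/-! ### Counting nodes by their states -/

theorem InTree.child_injective {n m : Node} {x y : Sgn} (hn : InTree n) (hm : InTree m)
    (h : n.child x = m.child y) : n = m ∧ x = y := by
  obtain ⟨h1, h2⟩ := hn.parents
  obtain ⟨h3, h4⟩ := hm.parents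
  obtain ⟨⟨a, b⟩, ⟨c, d⟩, ⟨e, f⟩⟩ := n
  obtain ⟨⟨a', b'⟩, ⟨c', d'⟩, ⟨e', f'⟩⟩ := m
  simp only [Prod.mk_add_mk, Prod.mk.injEq] at h1 h2 h3 h4
  cases x <;> cases y <;>
    simp only [Node.child, Node.mk.injEq, Prod.mk_add_mk, Prod.mk.injEq] at h
  · refine ⟨?_, rfl⟩
    simp only [Node.mk.injEq, Prod.mk.injEq]
    omega
  -- A positive child equal to a negative child would force a parent (0, 0), against determinant
  -- one.
  · obtain rfl : e = 0 := by omega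
    obtain rfl : f = 0 := by omega
    simp at h2
  · obtain rfl : c = 0 := by omega
    obtain rfl : d = 0 := by omega
    simp at h2
  · refine ⟨?_, rfl⟩
    simp only [Node.mk.injEq, Prod.mk.injEq]
    omega

theorem card_filter_level_succ (k : ℕ) (q : Node → Prop) [DecidablePred q] :
    ((level (k + 1)).filter q).card = ∑ x, ((level k).filter fun n => q (n.child x)).card := by
  have h : (level (k + 1)).filter q = Finset.univ.biUnion fun x : Sgn =>
      ((level k).filter fun n => q (n.child x)).image fun n => n.child x := by
    ext n
    simp only [Finset.mem_filter, mem_level_succ, Finset.mem_biUnion, Finset.mem_univ, true_and,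
      Finset.mem_image]
    constructor
    · rintro ⟨⟨m, hm, x, rfl⟩, hq⟩
      exact ⟨x, m, ⟨hm, hq⟩, rfl⟩
    · rintro ⟨x, m, ⟨hm, hq⟩, rfl⟩
      exact ⟨⟨m, hm, x, rfl⟩, hq⟩
  rw [h, Finset.card_biUnion]
  · refine Finset.sum_congr rfl fun x _ => Finset.card_image_of_injOn ?_
    intro n hn m hm hnm
    simp only [Finset.coe_filter, Set.mem_ofPred_eq] at hn hm
    exact (InTree.child_injective ⟨k, hn.1⟩ ⟨k, hm.1⟩ hnm).1
  · intro x _ y _ hxy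
    refine Finset.disjoint_left.2 fun n hx hy => ?_
    simp only [Finset.mem_image, Finset.mem_filter] at hx hy
    obtain ⟨m, ⟨hm, -⟩, rfl⟩ := hx
    obtain ⟨m', ⟨hm', -⟩, h'⟩ := hy
    exact hxy (InTree.child_injective ⟨k, hm'⟩ ⟨k, hm⟩ h').2.symm

theorem sum_sgn {M : Type*} [AddCommMonoid M] (f : Sgn → M) :
    ∑ x, f x = f Sgn.pos + f Sgn.neg := by
  rw [show (Finset.univ : Finset Sgn) = {Sgn.pos, Sgn.neg} from rfl, Finset.sum_pair (by decide)]

theorem card_level (k : ℕ) : (level k).card = 2 ^ k := by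
  induction k with
  | zero => simp [level]
  | succ k ih =>
    have := card_filter_level_succ k fun _ => True
    simp only [Finset.filter_true, sum_sgn, ih] at this
    rw [this, pow_succ, mul_two]

/-- The number of nodes at depth `k` in a given state. -/
def nodeCount (k : ℕ) (i : Fin 27) : ℕ := ((level k).filter fun n => n.state = stateOf i).card

theorem card_filter_level {k : ℕ} {q : Node → Prop} [DecidablePred q] {Q : Fin 27 → Prop}
    [DecidablePred Q] (h : ∀ n i, InTree n → n.state = stateOf i → (q n ↔ Q i)) :
    ((level k).filter q).card = ∑ i with Q i, nodeCount k i := by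
  have h1 : (level k).filter q = (Finset.univ.filter Q).biUnion fun i =>
      (level k).filter fun n => n.state = stateOf i := by
    ext n
    simp only [Finset.mem_filter, Finset.mem_biUnion, Finset.mem_univ, true_and]
    constructor
    · rintro ⟨hn, hq⟩
      obtain ⟨i, hi⟩ := InTree.exists_state ⟨k, hn⟩
      exact ⟨i, (h n i ⟨k, hn⟩ hi).1 hq, hn, hi⟩
    · rintro ⟨i, hQ, hn, hi⟩
      exact ⟨hn, (h n i ⟨k, hn⟩ hi).2 hQ⟩
  rw [h1, Finset.card_biUnion]
  · rfl
  · intro i _ j _ hij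
    refine Finset.disjoint_left.2 fun n hn hn' => ?_
    simp only [Finset.mem_filter] at hn hn'
    exact hij (stateOf_injective (hn.2.symm.trans hn'.2))

theorem nodeCount_succ (k : ℕ) (j : Fin 27) :
    nodeCount (k + 1) j = ∑ x, ∑ i with next x i = j, nodeCount k i := by
  rw [nodeCount, card_filter_level_succ]
  refine Finset.sum_congr rfl fun x _ => card_filter_level fun n i hn hi => ?_
  rw [hn.state_child, hi, step_stateOf, stateOf_injective.eq_iff]

theorem sum_nodeCount (k : ℕ) : ∑ i, nodeCount k i = 2 ^ k := by
  have := card_filter_level (k := k) (q := fun _ => True) (Q := fun _ => True)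
    fun _ _ _ _ => Iff.rfl
  simpa [card_level] using this.symm

/-! ### Labels -/

/-- The label of the edge to the child of sign `p.2` of a node in state `p.1`. -/
def labelOf (p : Fin 27 × Sgn) : Label :=
  ((stateOf p.1).orientation, (stateOf (next p.2 p.1)).orientation, p.2)

theorem InTree.edgeLabel_eq {n : Node} (h : InTree n) {i : Fin 27} (hi : n.state = stateOf i)
    (x : Sgn) : n.edgeLabel x = labelOf (i, x) := by
  rw [Node.edgeLabel, labelOf, h.orientation_eq, (h.child x).orientation_eq, h.state_child, hi,
    step_stateOf]

theorem labelOf_injective : Function.Injective labelOf := by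
  rintro ⟨i, x⟩ ⟨j, y⟩ h
  simp only [labelOf, Prod.mk.injEq] at h
  obtain ⟨h1, h2, rfl⟩ := h
  rw [← step_stateOf, ← step_stateOf] at h2
  rw [stateOf_injective (State.eq_of_orientation_eq h1 h2)]

theorem mem_edgeLabels {e : Label} : e ∈ edgeLabels ↔ ∃ p, labelOf p = e := by
  simp only [edgeLabels, Finset.mem_filter, Finset.mem_univ, true_and]
  constructor
  · rintro ⟨n, x, hn, rfl⟩
    obtain ⟨i, hi⟩ := hn.exists_state
    exact ⟨(i, x), (hn.edgeLabel_eq hi x).symm⟩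
  · rintro ⟨⟨i, x⟩, rfl⟩
    obtain ⟨n, hn, hi⟩ := exists_inTree_state i
    exact ⟨n, x, hn, hn.edgeLabel_eq hi x⟩

/-- An edge label amounts to a state and a sign. -/
noncomputable def labelEquiv : Fin 27 × Sgn ≃ edgeLabels :=
  Equiv.ofBijective (fun p => ⟨labelOf p, mem_edgeLabels.2 ⟨p, rfl⟩⟩)
    ⟨fun _ _ h => labelOf_injective (congrArg Subtype.val h),
      fun e => (mem_edgeLabels.1 e.2).imp fun _ h => Subtype.ext h⟩

theorem coe_labelEquiv (p : Fin 27 × Sgn) : (labelEquiv p : Label) = labelOf p := rfl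

theorem card_edgeLabels : edgeLabels.card = 54 := by
  rw [← Fintype.card_coe, ← Fintype.card_congr labelEquiv]
  rfl

/-- A label determines the state, so whether another label can follow does not depend on the edge
chosen to represent it. -/
theorem isChildLabel_labelOf {p q : Fin 27 × Sgn} :
    IsChildLabel (labelOf p) (labelOf q) ↔ next p.2 p.1 = q.1 := by
  obtain ⟨i, x⟩ := p
  obtain ⟨j, y⟩ := q
  have hchild : ∀ {n i x}, InTree n → n.state = stateOf i →
      (n.child x).state = stateOf (next x i) := by
    intro n i x hn hi
    rw [hn.state_child, hi, step_stateOf]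
  constructor
  · rintro ⟨n, s, s', hn, h1, h2⟩
    obtain ⟨l, hl⟩ := hn.exists_state
    rw [hn.edgeLabel_eq hl] at h1
    rw [(hn.child s).edgeLabel_eq (hchild hn hl)] at h2
    have h1' := labelOf_injective h1
    have h2' := labelOf_injective h2
    simp only [Prod.mk.injEq] at h1' h2'
    rw [← h1'.1, ← h1'.2, h2'.1]
  · intro h
    simp only at h
    obtain ⟨n, hn, hi⟩ := exists_inTree_state i
    refine ⟨n, x, y, hn, hn.edgeLabel_eq hi x, ?_⟩
    rw [(hn.child x).edgeLabel_eq (hchild hn hi), h]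

theorem transition_labelEquiv (p q : Fin 27 × Sgn) :
    transition (labelEquiv p) (labelEquiv q) = if next p.2 p.1 = q.1 then 1 / 2 else 0 := by
  simp only [transition, Matrix.of_apply, coe_labelEquiv, isChildLabel_labelOf]

theorem transition_nonneg (e f : edgeLabels) : 0 ≤ transition e f := by
  rw [transition, Matrix.of_apply]
  split_ifs <;> norm_num

theorem transition_row_sum (e : edgeLabels) : ∑ f, transition e f = 1 := by
  obtain ⟨p, rfl⟩ := labelEquiv.surjective e
  rw [← Equiv.sum_comp labelEquiv]
  simp only [transition_labelEquiv, Fintype.sum_prod_type, sum_sgn, Finset.sum_add_distrib,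
    Finset.sum_ite_eq, Finset.mem_univ, if_true]
  norm_num

/-- For each sign exactly one state leads to the state of `f`, so `f` has two predecessors of weight
1/2. -/
theorem transition_col_sum (f : edgeLabels) : ∑ e, transition e f = 1 := by
  obtain ⟨q, rfl⟩ := labelEquiv.surjective f
  rw [← Equiv.sum_comp labelEquiv]
  have h : ∀ x, ∑ i, (if next x i = q.1 then (1 / 2 : ℝ) else 0) = 1 / 2 := by
    intro x
    rw [Function.Bijective.sum_comp (next_bijective x) fun i => if i = q.1 then (1 / 2 : ℝ) else 0]
    simp
  simp only [transition_labelEquiv, Fintype.sum_prod_type_right, sum_sgn, h]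
  norm_num

/-- The edge's own sign x makes the first move, hence the exponent `w.length + 1`; the sign y of the
final edge is free. -/
theorem transition_pow_pos (w : List Sgn) : ∀ (i : Fin 27) (x y : Sgn),
    0 < (transition ^ (w.length + 1)) (labelEquiv (i, x))
      (labelEquiv (w.foldl (fun i x => next x i) (next x i), y)) := by
  induction w with
  | nil =>
    intro i x y
    simp [transition_labelEquiv]
  | cons z w ih =>
    intro i x y
    rw [List.length_cons, pow_succ', Matrix.mul_apply]
    refine Finset.sum_pos' (fun e _ => mul_nonneg (transition_nonneg _ _)
      (pow_nonneg_apply transition_nonneg _ _ _))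
      ⟨labelEquiv (next x i, z), Finset.mem_univ _, mul_pos ?_ (ih (next x i) z y)⟩
    simp [transition_labelEquiv]

theorem transition_pow_seven_pos (e : edgeLabels) :
    0 < (transition ^ 7) e (labelEquiv (0, Sgn.pos)) := by
  obtain ⟨⟨i, x⟩, rfl⟩ := labelEquiv.surjective e
  obtain ⟨w, hw, h0⟩ := exists_path_to_zero (next x i)
  have := transition_pow_pos w i x Sgn.pos
  rwa [hw, h0] at this

theorem sum_uniform : ∑ _e : edgeLabels, (1 / 54 : ℝ) = 1 := by
  rw [Finset.sum_const, Finset.card_univ, Fintype.card_coe, card_edgeLabels]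
  norm_num

theorem uniform_vecMul_transition :
    (fun _ => 1 / 54 : edgeLabels → ℝ) ᵥ* transition = fun _ => 1 / 54 := by
  ext f
  simp only [Matrix.vecMul, dotProduct]
  rw [← Finset.mul_sum, transition_col_sum, mul_one]

/-! ### Frequencies -/

theorem edgeFreq_labelOf (k : ℕ) (p : Fin 27 × Sgn) :
    edgeFreq k (labelOf p) = nodeCount k p.1 / (2 ^ k * 2) := by
  obtain ⟨i, x⟩ := p
  have h : (level k ×ˢ Finset.univ).filter (fun p : Node × Sgn => p.1.edgeLabel p.2 = labelOf (i, x))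
      = ((level k).filter fun n => n.state = stateOf i) ×ˢ {x} := by
    ext ⟨n, y⟩
    simp only [Finset.mem_filter, Finset.mem_product, Finset.mem_univ, and_true,
      Finset.mem_singleton, and_assoc]
    refine and_congr_right fun hn => ?_
    obtain ⟨j, hj⟩ := InTree.exists_state ⟨k, hn⟩
    rw [InTree.edgeLabel_eq ⟨k, hn⟩ hj, labelOf_injective.eq_iff, hj, stateOf_injective.eq_iff,
      Prod.mk.injEq]
  rw [edgeFreq, h, Finset.card_product, Finset.card_product, card_level, Finset.card_singleton,
    mul_one, show (Finset.univ : Finset Sgn).card = 2 from rfl, nodeCount]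
  push_cast
  rfl

/-- Both edges below each edge are counted among twice as many edges, so the proportions evolve
exactly, not only asymptotically, by the matrix. -/
theorem edgeFreq_succ (k : ℕ) :
    (fun e : edgeLabels => edgeFreq (k + 1) e) =
      (fun e : edgeLabels => edgeFreq k e) ᵥ* transition := by
  ext f
  obtain ⟨q, rfl⟩ := labelEquiv.surjective f
  simp only [Matrix.vecMul, dotProduct]
  rw [← Equiv.sum_comp labelEquiv]
  simp only [coe_labelEquiv, edgeFreq_labelOf, transition_labelEquiv, mul_ite, mul_zero,
    Fintype.sum_prod_type_right]
  simp only [← Finset.sum_filter, ← Finset.sum_mul, ← Finset.sum_div]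
  rw [nodeCount_succ]
  push_cast
  ring

theorem sum_edgeFreq_zero : ∑ e : edgeLabels, edgeFreq 0 e = 1 := by
  rw [← Equiv.sum_comp labelEquiv]
  simp only [coe_labelEquiv, edgeFreq_labelOf, Fintype.sum_prod_type_right, ← Finset.sum_div,
    sum_sgn, ← Nat.cast_sum, sum_nodeCount]
  norm_num

theorem edgeFreq_eq_vecMul_pow (k : ℕ) :
    (fun e : edgeLabels => edgeFreq k e) =
      (fun e : edgeLabels => edgeFreq 0 e) ᵥ* transition ^ k := by
  induction k with
  | zero => simp
  | succ k ih => rw [edgeFreq_succ, ih, Matrix.vecMul_vecMul, ← pow_succ]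

theorem tendsto_edgeFreq (e : edgeLabels) :
    Tendsto (fun k : ℕ => edgeFreq k e) atTop (𝓝 (1 / 54)) := by
  have h := tendsto_vecMul_pow transition_nonneg transition_row_sum transition_pow_seven_pos
    sum_uniform uniform_vecMul_transition sum_edgeFreq_zero
  simp only [← edgeFreq_eq_vecMul_pow] at h
  exact tendsto_pi_nhds.1 h e

theorem tendsto_nodeCount (i : Fin 27) :
    Tendsto (fun k : ℕ => (nodeCount k i : ℝ) / 2 ^ k) atTop (𝓝 (1 / 27)) := by
  -- Each node has one positive edge, but there are twice as many edges as nodes.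
  have h := (tendsto_edgeFreq (labelEquiv (i, Sgn.pos))).const_mul 2
  simp only [coe_labelEquiv, edgeFreq_labelOf] at h
  convert h using 2
  · field_simp
  · norm_num

/-- Each state has limiting weight 1/27 = 2/54, which explains the factor 2 in `hc`. -/
theorem tendsto_card_filter_level {q : Node → Prop} [DecidablePred q] {Q : Fin 27 → Prop}
    [DecidablePred Q] (h : ∀ n i, InTree n → n.state = stateOf i → (q n ↔ Q i)) {c : ℕ}
    (hc : (Finset.univ.filter Q).card * 2 = c) :
    Tendsto (fun k : ℕ => (((level k).filter q).card : ℝ) / (level k).card) atTop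
      (𝓝 ((c : ℝ) / 54)) := by
  have h1 := tendsto_finsetSum (Finset.univ.filter Q) fun i _ => tendsto_nodeCount i
  simp only [card_filter_level h, card_level, Nat.cast_sum, Nat.cast_pow, Nat.cast_ofNat,
    Finset.sum_div]
  convert h1 using 2
  rw [Finset.sum_const, ← hc, nsmul_eq_mul]
  push_cast
  ring

/-! ### Orientations and end vertices -/

theorem exists_row (i : Fin 27) : ∃ row ∈ orientationTable, ⇑(stateOf i).orientation = row.1 := by
  revert i; decide +kernel

theorem exists_state_of_row : ∀ row ∈ orientationTable,
    ∃ i, ⇑(stateOf i).orientation = row.1 := by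
  decide +kernel

theorem orientation_card : ∀ row ∈ orientationTable,
    (Finset.univ.filter fun i => ⇑(stateOf i).orientation = row.1).card * 2 = row.2.2 := by
  decide +kernel

/-- This finite check supplies, for each row, the corner that `wordVertex_eq` needs. -/
theorem exists_corner : ∀ row ∈ orientationTable, ∀ i : Fin 27,
    ⇑(stateOf i).orientation = row.1 → ∃ c : Corner, c.label = row.2.1 ∧
      c.diagonal = (stateOf i).orientation 3 ∧
      c.parity = decide (Equiv.Perm.sign (stateOf i).orientation = -1) := by
  decide +kernel

theorem exists_orientation_iff (p : Equiv.Perm (Fin 4)) :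
    (∃ n, InTree n ∧ n.orientation = p) ↔ ∃ row ∈ orientationTable, ⇑p = row.1 := by
  constructor
  · rintro ⟨n, hn, rfl⟩
    obtain ⟨i, hi⟩ := hn.exists_state
    rw [hn.orientation_eq, hi]
    exact exists_row i
  · rintro ⟨row, hrow, hp⟩
    obtain ⟨i, hi⟩ := exists_state_of_row row hrow
    obtain ⟨n, hn, h⟩ := exists_inTree_state i
    refine ⟨n, hn, ?_⟩
    rw [hn.orientation_eq, h]
    exact DFunLike.coe_injective (hi.trans hp.symm)

theorem InTree.endVertex_eq {n : Node} (hn : InTree n) {row : (Fin 4 → Fin 4) × Fin 8 × ℕ}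
    (hrow : row ∈ orientationTable) (h : ⇑n.orientation = row.1) : n.endVertex = row.2.1 := by
  obtain ⟨i, hi⟩ := hn.exists_state
  rw [hn.orientation_eq, hi] at h
  obtain ⟨c, h1, h2, h3⟩ := exists_corner row hrow i h
  rw [← hi, ← hn.orientation_eq] at h2 h3
  rw [Node.endVertex, wordVertex_eq h2 h3, h1]

/-- The end vertex of the nodes in a state, as a predicate. -/
def EndsAt (v : Fin 8) (i : Fin 27) : Prop :=
  ∃ row ∈ orientationTable, ⇑(stateOf i).orientation = row.1 ∧ row.2.1 = v

instance (v : Fin 8) : DecidablePred (EndsAt v) := fun i => by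
  unfold EndsAt; infer_instance

theorem InTree.endVertex_eq_iff {n : Node} (hn : InTree n) {i : Fin 27}
    (hi : n.state = stateOf i) (v : Fin 8) : n.endVertex = v ↔ EndsAt v i := by
  have h : ⇑n.orientation = ⇑(stateOf i).orientation := by rw [hn.orientation_eq, hi]
  constructor
  · rintro rfl
    obtain ⟨row, hrow, h'⟩ := exists_row i
    exact ⟨row, hrow, h', (hn.endVertex_eq hrow (h.trans h')).symm⟩
  · rintro ⟨row, hrow, h', rfl⟩
    exact hn.endVertex_eq hrow (h.trans h')

theorem tendsto_orientationFreq {row : (Fin 4 → Fin 4) × Fin 8 × ℕ}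
    (hrow : row ∈ orientationTable) :
    Tendsto (fun k : ℕ => orientationFreq k row.1) atTop (𝓝 ((row.2.2 : ℝ) / 54)) :=
  tendsto_card_filter_level (fun n i hn hi => by rw [hn.orientation_eq, hi])
    (orientation_card row hrow)

theorem tendsto_vertexFreq {v : Fin 8} {c : ℕ}
    (hc : (Finset.univ.filter (EndsAt v)).card * 2 = c) :
    Tendsto (fun k : ℕ => vertexFreq k v) atTop (𝓝 ((c : ℝ) / 54)) :=
  tendsto_card_filter_level (fun _ _ hn hi => hn.endVertex_eq_iff hi v) hc

end CubeGeodesic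

theorem mainTheorem1 :
    -- the labels, the orientations, and the end vertex of each orientation
    edgeLabels.card = 54 ∧
    (∀ p : Equiv.Perm (Fin 4),
      (∃ n, InTree n ∧ n.orientation = p) ↔ ∃ row ∈ orientationTable, ⇑p = row.1) ∧
    (∀ n, InTree n → ∀ row ∈ orientationTable, ⇑n.orientation = row.1 → n.endVertex = row.2.1) ∧
    -- the transition matrix is stochastic, with the uniform distribution as its only stationary one
    (∀ e, ∑ f, transition e f = 1) ∧
    (∀ μ : edgeLabels → ℝ, (∀ e, 0 ≤ μ e) → ∑ e, μ e = 1 →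
      (μ ᵥ* transition = μ ↔ μ = fun _ => 1 / 54)) ∧
    -- convergence to the uniform distribution
    Tendsto (fun k : ℕ => transition ^ k) atTop (𝓝 (Matrix.of fun _ _ => 1 / 54)) ∧
    (∀ μ : edgeLabels → ℝ, (∀ e, 0 ≤ μ e) → ∑ e, μ e = 1 →
      Tendsto (fun k : ℕ => μ ᵥ* transition ^ k) atTop (𝓝 fun _ => 1 / 54)) ∧
    (∀ e ∈ edgeLabels, Tendsto (fun k : ℕ => edgeFreq k e) atTop (𝓝 (1 / 54))) ∧
    -- the limiting proportions of the orientations and of the end vertices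
    (∀ row ∈ orientationTable,
      Tendsto (fun k : ℕ => orientationFreq k row.1) atTop (𝓝 ((row.2.2 : ℝ) / 54))) ∧
    Tendsto (fun k : ℕ => vertexFreq k 7) atTop (𝓝 (12 / 54)) ∧
    (∀ v : Fin 8, v = 1 ∨ v = 2 ∨ v = 4 →
      Tendsto (fun k : ℕ => vertexFreq k v) atTop (𝓝 (8 / 54))) ∧
    (∀ v : Fin 8, v = 3 ∨ v = 5 ∨ v = 6 →
      Tendsto (fun k : ℕ => vertexFreq k v) atTop (𝓝 (6 / 54))) := by
  have h0 := transition_nonneg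
  have h1 := transition_row_sum
  have hK := transition_pow_seven_pos
  have hπ := sum_uniform
  have hπA := uniform_vecMul_transition
  refine ⟨card_edgeLabels, exists_orientation_iff, fun n hn row hrow h => hn.endVertex_eq hrow h,
    h1, fun μ _ hμ => vecMul_eq_self_iff_of_doeblin h0 h1 hK hπ hπA hμ,
    tendsto_pow_of_doeblin h0 h1 hK hπ hπA,
    fun μ _ hμ => tendsto_vecMul_pow h0 h1 hK hπ hπA hμ,
    fun e he => tendsto_edgeFreq ⟨e, he⟩, fun row hrow => tendsto_orientationFreq hrow, ?_, ?_, ?_⟩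
  · exact_mod_cast tendsto_vertexFreq (v := 7) (c := 12) (by decide +kernel)
  · have : ∀ v : Fin 8, v = 1 ∨ v = 2 ∨ v = 4 →
        (Finset.univ.filter (EndsAt v)).card * 2 = 8 := by decide +kernel
    exact fun v hv => by exact_mod_cast tendsto_vertexFreq (this v hv)
  · have : ∀ v : Fin 8, v = 3 ∨ v = 5 ∨ v = 6 →
        (Finset.univ.filter (EndsAt v)).card * 2 = 6 := by decide +kernel
    exact fun v hv => by exact_mod_cast tendsto_vertexFreq (this v hv)
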